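/- Let $\mathfrak T$ be a deterministic Turing machine with tape symbols $a_0=0$ (the blank), $a_1=1,a_2,\dots,a_m$ ($m\ge1$), states $q_0$ (final, without instructions), $q_1$ (initial), $q_2,\dots,q_n$ ($n\ge1$), and at most one instruction $q_\alpha a_i\to q_\beta a_j$, $q_\alpha a_i\to q_\beta L$ or $q_\alpha a_i\to q_\beta R$ for each pair $(\alpha,i)$. A configuration is a word $\mathfrak a q_w a_l\mathfrak b$ with $\mathfrak a,\mathfrak b$ (possibly empty) words in the tape symbols; the machine may add blank cells on the right but not on the left. We say that $\mathfrak T$ computes a partial function $E:\mathbb N\rightharpoonup\mathbb N$ if for every $x$: when $E(x)$ is defined, $\mathfrak T$ passes from the configuration $q_1 01^x$ to $q_0 01^{E(x)}0^s$ for some $s\ge 0$ in finitely many steps; when $E(x)$ is undefined, $\mathfrak T$ never reaches the state $q_0$ from $q_1 01^x$. The associative calculus $A(\mathfrak T)$ is the monoid with generators $a_0,\dots,a_m,q_0,\dots,q_n,v$ and defining relations $q_\alpha a_i\equiv q_\beta a_j$ for each instruction $q_\alpha a_i\to q_\beta a_j$; $a_kq_\alpha a_i\equiv q_\beta a_ka_i$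 ($k=0,\dots,m$) for each instruction $q_\alpha a_i\to q_\beta L$; $q_\alpha a_i\equiv a_iq_\beta$ for each instruction $q_\alpha a_i\to q_\beta R$; and $a_0v\equiv v$. There exist a partial recursive function $E$ with values in $\{0,1\}$ that has no total recursive extension, and a Turing machine $\mathfrak T$ that computes $E$. For every such $E$ and every such $\mathfrak T$, the left divisibility problem for the element $q_0v$ in $A(\mathfrak T)$ is undecidable: there is no algorithm that decides, given a word $\mathfrak a$ in the generators, whether there is a (possibly empty) word $\xi$ with $\mathfrak a\xi\equiv q_0v$ in $A(\mathfrak T)$. -/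

import Mathlib

namespace AssocCalculus

/-- Right-hand side of an instruction `q_α a_i → …`, for `m + 2` symbols and `n + 2` states. -/
inductive Instr (m n : ℕ) where
  /-- `q_β a_j`: print `a_j` and enter `q_β`. -/
  | write (β : Fin (n + 2)) (j : Fin (m + 2))
  /-- `q_β L`: move one cell to the left and enter `q_β`. -/
  | left (β : Fin (n + 2))
  /-- `q_β R`: move one cell to the right and enter `q_β`. -/
  | right (β : Fin (n + 2))

/-- A deterministic Turing machine with tape symbols `a_0 = 0` (blank), `a_1 = 1`, …, `a_{m+1}`
and states `q_0` (final), `q_1` (initial), …, `q_{n+1}`. -/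
structure TuringMachine where
  m : ℕ
  n : ℕ
  /-- The (at most one) instruction with left-hand side `q_α a_i`. -/
  instr : Fin (n + 2) → Fin (m + 2) → Option (Instr m n)
  /-- The final state has no instructions. -/
  final : ∀ i, instr 0 i = none

namespace TuringMachine

variable (T : TuringMachine)

/-- The configuration `𝔞 q_w a_l 𝔟`. The word `𝔞` to the left of the scanned cell is stored
with the cell nearest to the head first, so `left = 𝔞.reverse`; `right = 𝔟`. -/
@[ext]
structure Config where
  left : List (Fin (T.m + 2))
  state : Fin (T.n + 2)
  scanned : Fin (T.m + 2)
  right : List (Fin (T.m + 2))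

/-- One step of the machine without adding cells on the left: a move to the left from the leftmost
cell is not possible, a move to the right from the last cell adds a blank cell. -/
def step (c : T.Config) : Option T.Config :=
  match T.instr c.state c.scanned with
  | none => none
  | some (.write β j) => some ⟨c.left, β, j, c.right⟩
  | some (.left β) =>
    match c.left with
    | [] => none
    | k :: l => some ⟨l, β, k, c.scanned :: c.right⟩
  | some (.right β) =>
    match c.right with
    | [] => some ⟨c.scanned :: c.left, β, 0, []⟩
    | k :: r => some ⟨c.scanned :: c.left, β, k, r⟩

/-- `c` is transformed into `d` in a finite number of steps, without adding cells on the left. -/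
def Reaches : T.Config → T.Config → Prop :=
  Relation.ReflTransGen fun c d => T.step c = some d

/-- The configuration `q_1 0 1^x`. -/
def initial (x : ℕ) : T.Config := ⟨[], 1, 0, List.replicate x 1⟩

/-- The configuration `q_0 0 1^y 0^s`. -/
def output (y s : ℕ) : T.Config := ⟨[], 0, 0, List.replicate y 1 ++ List.replicate s 0⟩

/-- `T` computes the partial function `E`: from `q_1 0 1^x` it comes to `q_0 0 1^{E(x)} 0^s` for
some `s` if `E(x)` is defined, and it never comes to the final state if `E(x)` is undefined. -/
def Computes (E : ℕ →. ℕ) : Prop :=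
  ∀ x, (∀ y ∈ E x, ∃ s, T.Reaches (T.initial x) (T.output y s)) ∧
    (¬ (E x).Dom → ∀ c, T.Reaches (T.initial x) c → c.state ≠ 0)

/-- The alphabet `a_0, …, a_{m+1}, q_0, …, q_{n+1}, v` of `A(T)`. -/
abbrev Letter : Type := Fin (T.m + 2) ⊕ Fin (T.n + 2) ⊕ Unit

/-- The letter `a_i`. -/
def a (i : Fin (T.m + 2)) : T.Letter := Sum.inl i

/-- The letter `q_α`. -/
def q (α : Fin (T.n + 2)) : T.Letter := Sum.inr (Sum.inl α)

/-- The additional letter `v`. -/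
def v : T.Letter := Sum.inr (Sum.inr ())

/-- The defining relations of the associative calculus `A(T)`. -/
inductive Relations : List T.Letter → List T.Letter → Prop
  | write {α i β j} (h : T.instr α i = some (.write β j)) :
      Relations [T.q α, T.a i] [T.q β, T.a j]
  | left {α i β} (h : T.instr α i = some (.left β)) (k : Fin (T.m + 2)) :
      Relations [T.a k, T.q α, T.a i] [T.q β, T.a k, T.a i]
  | right {α i β} (h : T.instr α i = some (.right β)) :
      Relations [T.q α, T.a i] [T.a i, T.q β]
  | blank : Relations [T.a 0, T.v] [T.v]

end TuringMachine

/-- Equality `u ≡ w` of words in the associative calculus with alphabet `α` and defining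
relations `R`: the congruence on the free monoid generated by `R`. -/
def WordEquiv {α : Type} (R : List α → List α → Prop) (u w : List α) : Prop :=
  conGen (fun x y : FreeMonoid α => R x.toList y.toList) (FreeMonoid.ofList u) (FreeMonoid.ofList w)

/-- The left divisibility problem for the fixed element `c` is decidable: there is an algorithm
that decides for any word `a` whether `a ξ ≡ c` has a solution `ξ`. -/
def LeftDivisibilityDecidable {α : Type} [Primcodable α] (R : List α → List α → Prop)
    (c : List α) : Prop :=
  ComputablePred fun a : List α => ∃ ξ : List α, WordEquiv R (a ++ ξ) c

/-- `E` is a partial recursive function with values `0` and `1` and without recursive extensions.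
(Hence the sets `{x | E x = 0}` and `{x | E x = 1}` are recursively enumerable, not recursive.) -/
structure IsInextensible (E : ℕ →. ℕ) : Prop where
  partrec : Partrec E
  values : ∀ x, ∀ y ∈ E x, y = 0 ∨ y = 1
  no_extension : ¬ ∃ f : ℕ → ℕ, Computable f ∧ ∀ x, ∀ y ∈ E x, f x = y

end AssocCalculus

/-! Undecidability. Each step of `T` on a configuration closed by `v` is an identity of `A(T)`: the
relations copy the instructions, and `a_0 v ≡ v` creates or absorbs trailing blanks. So if `E x =
0`, then `q_1 0 1^x v ≡ q_0 v`, and `ξ = []` is a solution (`exists_dvd_of_mem_zero`). For `E x = 1`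
an invariant of `≡` is needed. A word is read from right to left as a configuration on a tape
infinite to the right, and is accepted if the machine, run from it, ends in `q_0` at the left end of
a blank tape. A defining relation used inside any context either makes one machine step, which does
not affect acceptance because `T` is deterministic and `q_0` has no instructions, or leaves
acceptance unchanged (`accepted_iff_of_relation`). Since `q_0 v` is accepted, so is `q_1 0 1^x v ξ`;
then `ξ` is empty, because nothing may follow `v`, and the run ends in the unaccepted `q_0 0 1 0^s`
(`not_exists_dvd_of_mem_one`). A decision procedure would thus separate `E x = 0` from `E x = 1`,
giving a total recursive extension of `E`; its answers where `E` is undefined do not matter.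

Existence. Running the program with number `x` on `x` and altering the result gives an inextensible
`E` of the form "minimum search, then a primitive recursive function"
(`exists_isInextensible_rfind`). Primitive recursive functions are computed by while programs on
registers, and one more while loop does the search. Programs compile to register machine code, which
a Turing machine simulates with every register in unary on its own track (`exists_turingMachine`).
Divergence transfers because a deterministic machine that passes through infinitely many
configurations never stops. -/

namespace AssocCalculus

/-! ### Acceptance as an invariant of the associative calculus -/

namespace TuringMachine

variable (T : TuringMachine)

/-- A configuration on a tape that is infinite to the right: `right 0` is the scanned cell. -/
structure HalfConfig where
  left : List (Fin (T.m + 2))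
  state : Fin (T.n + 2)
  right : ℕ → Fin (T.m + 2)

/-- Put a cell in front of a right-infinite tape. -/
def consTape {γ : Type} (k : γ) (f : ℕ → γ) : ℕ → γ
  | 0 => k
  | i + 1 => f i

/-- One step on the right-infinite tape. -/
def stepHalf (c : T.HalfConfig) : Option T.HalfConfig :=
  match T.instr c.state (c.right 0) with
  | none => none
  | some (.write β j) => some ⟨c.left, β, consTape j fun i => c.right (i + 1)⟩
  | some (.left β) =>
    match c.left with
    | [] => none
    | k :: l => some ⟨l, β, consTape k c.right⟩
  | some (.right β) => some ⟨c.right 0 :: c.left, β, fun i => c.right (i + 1)⟩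

/-- Fill up a configuration with blanks on the right. -/
def Config.toHalf {T : TuringMachine} (c : T.Config) : T.HalfConfig :=
  ⟨c.left, c.state, consTape c.scanned fun i => c.right.getD i 0⟩

def ReachesHalf : T.HalfConfig → T.HalfConfig → Prop :=
  Relation.ReflTransGen fun c d => T.stepHalf c = some d

variable {T}

/-- The blank cell added by a move off the right end is already present on the infinite tape, so
trailing blanks play no role there, just as `a_0 v ≡ v` makes them irrelevant in `A(T)`. -/
theorem stepHalf_toHalf (c : T.Config) : T.stepHalf c.toHalf = (T.step c).map Config.toHalf := by
  obtain ⟨l, s, x, r⟩ := c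
  simp only [stepHalf, step, Config.toHalf, consTape]
  rcases T.instr s x with _ | (⟨β, j⟩ | β | β)
  · simp
  · rfl
  · cases l with
    | nil => simp
    | cons k l =>
      simp only [Option.map_some, Option.some.injEq, Config.toHalf, HalfConfig.mk.injEq, true_and]
      funext i
      rcases i with _ | _ | i <;> simp [consTape]
  · cases r with
    | nil =>
      simp only [Option.map_some, Option.some.injEq, Config.toHalf, HalfConfig.mk.injEq, true_and]
      funext i
      rcases i with _ | i <;> simp [consTape]
    | cons k r =>
      simp only [Option.map_some, Option.some.injEq, Config.toHalf, HalfConfig.mk.injEq, true_and]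
      funext i
      rcases i with _ | i <;> simp [consTape]

theorem Reaches.toHalf {c d : T.Config} (h : T.Reaches c d) :
    T.ReachesHalf c.toHalf d.toHalf := by
  refine Relation.ReflTransGen.lift Config.toHalf (fun a b hab => ?_) _ _ h
  change T.stepHalf a.toHalf = some b.toHalf
  rw [stepHalf_toHalf, hab, Option.map_some]

theorem exists_reaches_of_reachesHalf {c : T.Config} {h : T.HalfConfig}
    (H : T.ReachesHalf c.toHalf h) : ∃ d, T.Reaches c d ∧ d.toHalf = h := by
  induction H with
  | refl => exact ⟨c, .refl, rfl⟩
  | tail _ hs ih =>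
    obtain ⟨d, hd, rfl⟩ := ih
    rw [stepHalf_toHalf, Option.map_eq_some_iff] at hs
    obtain ⟨e, he, rfl⟩ := hs
    exact ⟨e, hd.tail he, rfl⟩

theorem stepHalf_final {c : T.HalfConfig} (h : c.state = 0) : T.stepHalf c = none := by
  simp [stepHalf, h, T.final]

/-- The machine stops in the final state, at the left end of a blank tape. -/
def Accepts (c : T.HalfConfig) : Prop :=
  ∃ d, T.ReachesHalf c d ∧ d.state = 0 ∧ d.left = [] ∧ ∀ i, d.right i = 0

/-- By determinism an accepting run from `c` must pass through `d`; it cannot have length zero,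
because the final state admits no step. -/
theorem accepts_iff_of_step {c d : T.HalfConfig} (h : T.stepHalf c = some d) :
    Accepts c ↔ Accepts d := by
  constructor
  · rintro ⟨e, he, h0, h1⟩
    rcases Relation.ReflTransGen.cases_head he with rfl | ⟨d', hd', hr⟩
    · rw [stepHalf_final h0] at h
      cases h
    · rw [h, Option.some.injEq] at hd'
      subst hd'
      exact ⟨e, hr, h0, h1⟩
  · rintro ⟨e, he, h0⟩
    exact ⟨e, .head h he, h0⟩

theorem accepts_final {c : T.HalfConfig} (h : c.state = 0) (hc : Accepts c) (i : ℕ) :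
    c.right i = 0 := by
  obtain ⟨e, he, -, -, h1⟩ := hc
  rcases Relation.ReflTransGen.cases_head he with rfl | ⟨d', hd', hr⟩
  · exact h1 i
  · rw [stepHalf_final h] at hd'
    cases hd'

/-- Append cells at the far left of the tape. -/
def HalfConfig.extend (c : T.HalfConfig) (k : Fin (T.m + 2)) : T.HalfConfig :=
  ⟨c.left ++ [k], c.state, c.right⟩

/-- A step that is possible never looks beyond the left end. Cells added there may only unblock a
left move, which the hypothesis says is not blocked. -/
theorem stepHalf_extend {c d : T.HalfConfig} (h : T.stepHalf c = some d) (k : Fin (T.m + 2)) :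
    T.stepHalf (c.extend k) = some (d.extend k) := by
  obtain ⟨l, s, r⟩ := c
  simp only [stepHalf, HalfConfig.extend] at h ⊢
  rcases hi : T.instr s (r 0) with _ | (⟨β, j⟩ | β | β)
  · simp [hi] at h
  · simp only [hi, Option.some.injEq] at h
    subst h; rfl
  · cases l with
    | nil => simp [hi] at h
    | cons k l =>
      simp only [hi, Option.some.injEq] at h
      subst h; rfl
  · simp only [hi, Option.some.injEq] at h
    subst h; rfl

variable (T) in
/-- The result of reading a word of `A(T)` from right to left. -/
inductive Reading
  | empty
  | tape (f : ℕ → Fin (T.m + 2))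
  | config (c : T.HalfConfig)
  | bad

/-- Read one more letter, on the left of what has been read. -/
def Reading.read : T.Letter → Reading T → Reading T
  | .inr (.inr ()), .empty => .tape fun _ => 0
  | .inl k, .tape f => .tape (consTape k f)
  | .inl k, .config c => .config (c.extend k)
  | .inr (.inl α), .tape f => .config ⟨[], α, f⟩
  | _, _ => .bad

def Reading.Accepted : Reading T → Prop
  | .config c => Accepts c
  | _ => False

/-- Read a whole word. -/
def reading (w : List T.Letter) : Reading T := w.foldr Reading.read .empty

theorem foldr_read_bad (x : List T.Letter) : x.foldr Reading.read .bad = Reading.bad := by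
  induction x with
  | nil => rfl
  | cons a x ih =>
    rw [List.foldr_cons, ih]
    rcases a with a | a | a <;> rfl

/-- The letter of `x` next to the configuration is read first, hence induction from the right end: a
tape symbol extends both configurations, any other letter spoils both. -/
theorem accepted_iff_of_step (x : List T.Letter) {c d : T.HalfConfig}
    (h : T.stepHalf c = some d) :
    (x.foldr Reading.read (.config c)).Accepted ↔
      (x.foldr Reading.read (.config d)).Accepted := by
  induction x using List.reverseRecOn generalizing c d with
  | nil => exact accepts_iff_of_step h
  | append_singleton x a ih =>
    rw [List.foldr_append, List.foldr_append]
    rcases a with a | a | a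
    · exact ih (stepHalf_extend h a)
    · exact Iff.rfl
    · exact Iff.rfl

/-- Only the reading of `y` matters. For an instruction, if `y` is a tape the two sides are
consecutive configurations, otherwise both are `bad`. For `a_0 v ≡ v` the blank tape absorbs a
blank. -/
theorem accepted_iff_of_relation {u w : List T.Letter} (h : T.Relations u w)
    (x y : List T.Letter) :
    (reading (x ++ u ++ y)).Accepted ↔ (reading (x ++ w ++ y)).Accepted := by
  simp only [reading, List.foldr_append]
  generalize y.foldr Reading.read .empty = s
  cases h with
  | @write α i β j h =>
    rcases s with _ | f | c | _
    · exact Iff.rfl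
    · apply accepted_iff_of_step
      simp only [stepHalf, consTape, h]
    · exact Iff.rfl
    · exact Iff.rfl
  | @left α i β h k =>
    rcases s with _ | f | c | _
    · exact Iff.rfl
    · apply accepted_iff_of_step
      simp only [stepHalf, HalfConfig.extend, List.nil_append, consTape, h]
    · exact Iff.rfl
    · exact Iff.rfl
  | @right α i β h =>
    rcases s with _ | f | c | _
    · exact Iff.rfl
    · apply accepted_iff_of_step
      simp only [stepHalf, HalfConfig.extend, List.nil_append, consTape, h]
    · exact Iff.rfl
    · exact Iff.rfl
  | blank =>
    rcases s with _ | f | c | _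
    · have : consTape (0 : Fin (T.m + 2)) (fun _ => 0) = fun _ => 0 := by
        funext i; cases i <;> rfl
      simp only [List.foldr_cons, List.foldr_nil, v, a, Reading.read, this]
    · exact Iff.rfl
    · exact Iff.rfl
    · exact Iff.rfl

variable (T) in
/-- The syntactic congruence of the set of accepted words. -/
def acceptCon : Con (FreeMonoid T.Letter) where
  r u w := ∀ x y : List T.Letter,
    (reading (x ++ u.toList ++ y)).Accepted ↔ (reading (x ++ w.toList ++ y)).Accepted
  iseqv :=
    { refl := fun _ _ _ => Iff.rfl
      symm := fun h x y => (h x y).symm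
      trans := fun h h' x y => (h x y).trans (h' x y) }
  mul' {u u' w w'} h h' x y := by
    have h1 := h x (w.toList ++ y)
    have h2 := h' (x ++ u'.toList) y
    simp only [FreeMonoid.toList_mul, List.append_assoc] at h1 h2 ⊢
    exact h1.trans h2

theorem accepted_iff_of_wordEquiv {u w : List T.Letter} (h : WordEquiv T.Relations u w) :
    (reading u).Accepted ↔ (reading w).Accepted := by
  have hle : conGen (fun x y : FreeMonoid T.Letter => T.Relations x.toList y.toList) ≤
      T.acceptCon := Con.conGen_le.2 fun x y hxy => accepted_iff_of_relation hxy
  simpa using hle h [] []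

end TuringMachine

namespace WordEquiv

variable {α : Type} {R : List α → List α → Prop} {u w z : List α}

theorem of (h : R u w) : WordEquiv R u w := ConGen.Rel.of _ _ h

theorem refl (u : List α) : WordEquiv R u u := ConGen.Rel.refl _

theorem symm (h : WordEquiv R u w) : WordEquiv R w u := ConGen.Rel.symm h

theorem trans (h : WordEquiv R u w) (h' : WordEquiv R w z) : WordEquiv R u z :=
  ConGen.Rel.trans h h'

theorem append_left (x : List α) (h : WordEquiv R u w) : WordEquiv R (x ++ u) (x ++ w) :=
  ConGen.Rel.mul (ConGen.Rel.refl (FreeMonoid.ofList x)) h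

theorem append_right (h : WordEquiv R u w) (x : List α) : WordEquiv R (u ++ x) (w ++ x) :=
  ConGen.Rel.mul h (ConGen.Rel.refl (FreeMonoid.ofList x))

end WordEquiv

/-! ### Computations as identities of words, and undecidability -/

namespace TuringMachine

variable {T : TuringMachine}

/-- The word of `A(T)` that stands for a configuration, closed by `v`. -/
def Config.word (c : T.Config) : List T.Letter :=
  c.left.reverse.map T.a ++ (T.q c.state :: T.a c.scanned :: c.right.map T.a ++ [T.v])

theorem wordEquiv_of_step {c d : T.Config} (h : T.step c = some d) :
    WordEquiv T.Relations c.word d.word := by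
  obtain ⟨l, s, x, r⟩ := c
  simp only [step] at h
  rcases hi : T.instr s x with _ | (⟨β, j⟩ | β | β)
  · simp [hi] at h
  · simp only [hi, Option.some.injEq] at h
    subst h
    exact ((WordEquiv.of (Relations.write hi)).append_right (r.map T.a ++ [T.v])).append_left _
  · cases l with
    | nil => simp [hi] at h
    | cons k l =>
      simp only [hi, Option.some.injEq] at h
      subst h
      simpa [Config.word] using ((WordEquiv.of (Relations.left hi k)).append_right
        (r.map T.a ++ [T.v])).append_left (l.reverse.map T.a)
  · cases r with
    | nil =>
      simp only [hi, Option.some.injEq] at h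
      subst h
      have h1 := ((WordEquiv.of (Relations.right hi)).append_right [T.v]).append_left
        (l.reverse.map T.a)
      -- The new blank under the head comes from `v` by using `a_0 v ≡ v` backwards.
      have h2 := (WordEquiv.of (R := T.Relations) .blank).symm.append_left
        (l.reverse.map T.a ++ [T.a x, T.q β])
      simp only [List.append_assoc] at h1 h2
      simpa [Config.word] using h1.trans h2
    | cons k r =>
      simp only [hi, Option.some.injEq] at h
      subst h
      simpa [Config.word] using ((WordEquiv.of (Relations.right hi)).append_right
        (T.a k :: r.map T.a ++ [T.v])).append_left (l.reverse.map T.a)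

theorem wordEquiv_of_reaches {c d : T.Config} (h : T.Reaches c d) :
    WordEquiv T.Relations c.word d.word := by
  induction h with
  | refl => exact .refl _
  | tail _ hs ih => exact ih.trans (wordEquiv_of_step hs)

theorem wordEquiv_blanks (s : ℕ) :
    WordEquiv T.Relations (List.replicate s (T.a 0) ++ [T.v]) [T.v] := by
  induction s with
  | zero => exact .refl _
  | succ s ih =>
    exact (ih.append_left [T.a 0]).trans (.of .blank)

theorem wordEquiv_output_zero (s : ℕ) :
    WordEquiv T.Relations (T.output 0 s).word [T.q 0, T.v] := by
  -- The scanned blank is absorbed together with the `s` blanks after it.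
  have := (wordEquiv_blanks (T := T) (s + 1)).append_left [T.q 0]
  simpa [output, Config.word, List.replicate_succ] using this

theorem reading_tape (r : List (Fin (T.m + 2))) :
    reading (r.map T.a ++ [T.v]) = .tape fun i => r.getD i 0 := by
  induction r with
  | nil => simp [reading, v, Reading.read]
  | cons k r ih =>
    change Reading.read (T.a k) (reading (r.map T.a ++ [T.v])) = _
    rw [ih]
    simp only [a, Reading.read, Reading.tape.injEq]
    funext i
    cases i <;> simp [consTape]

theorem reading_word {c : T.Config} (h : c.left = []) : reading c.word = .config c.toHalf := by
  have : c.word = T.q c.state :: ((c.scanned :: c.right).map T.a ++ [T.v]) := by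
    simp [Config.word, h]
  rw [this]
  change Reading.read (T.q c.state) (reading _) = _
  rw [reading_tape]
  simp only [q, Reading.read, Config.toHalf, h, Reading.config.injEq, HalfConfig.mk.injEq, true_and]
  funext i
  cases i <;> simp [consTape]

theorem accepted_blank : (reading [T.q 0, T.v]).Accepted :=
  ⟨_, .refl, rfl, rfl, fun _ => rfl⟩

/-- In the final state acceptance can be read off the current tape, and the cell to the right of the
head holds `1`. -/
theorem not_accepted_output_one (s : ℕ) : ¬ (reading (T.output 1 s).word).Accepted := by
  rw [reading_word rfl]
  intro h
  have := accepts_final rfl h 1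
  simp [output, Config.toHalf, consTape] at this

/-- An accepted word has nothing to the right of `v`. -/
theorem eq_nil_of_accepted {u ξ : List T.Letter} (h : (reading (u ++ T.v :: ξ)).Accepted) :
    ξ = [] := by
  rcases ξ with _ | ⟨b, ξ⟩
  · rfl
  · exfalso
    have : Reading.read T.v (reading (b :: ξ)) = .bad := by
      -- `v` can be read only before any other letter, and reading a letter never returns to
      -- `empty`.
      have hne : reading (b :: ξ) ≠ .empty := by
        change Reading.read b (reading ξ) ≠ _
        rcases b with b | b | b <;> rcases reading ξ with _ | _ | _ | _ <;> simp [Reading.read]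
      revert hne
      rcases reading (b :: ξ) with _ | _ | _ | _ <;> simp [Reading.read, v]
    rw [reading, List.foldr_append] at h
    change (u.foldr Reading.read (Reading.read T.v (reading (b :: ξ)))).Accepted at h
    rw [this, foldr_read_bad] at h
    exact h

theorem exists_dvd_of_mem_zero {E : ℕ →. ℕ} (hT : T.Computes E) {x : ℕ} (h : 0 ∈ E x) :
    ∃ ξ, WordEquiv T.Relations ((T.initial x).word ++ ξ) [T.q 0, T.v] := by
  obtain ⟨s, hs⟩ := (hT x).1 0 h
  refine ⟨[], ?_⟩
  rw [List.append_nil]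
  exact (wordEquiv_of_reaches hs).trans (wordEquiv_output_zero s)

theorem not_exists_dvd_of_mem_one {E : ℕ →. ℕ} (hT : T.Computes E) {x : ℕ} (h : 1 ∈ E x) :
    ¬ ∃ ξ, WordEquiv T.Relations ((T.initial x).word ++ ξ) [T.q 0, T.v] := by
  rintro ⟨ξ, hξ⟩
  obtain ⟨s, hs⟩ := (hT x).1 1 h
  have hacc := (accepted_iff_of_wordEquiv hξ).2 accepted_blank
  obtain rfl : ξ = [] := by
    refine eq_nil_of_accepted
      (u := T.q 1 :: T.a 0 :: (List.replicate x 1).map T.a) ?_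
    simpa [Config.word, initial] using hacc
  rw [List.append_nil] at hacc
  exact not_accepted_output_one s
    ((accepted_iff_of_wordEquiv (wordEquiv_of_reaches hs)).1 hacc)

theorem computable_initial_word : Computable fun x => (T.initial x).word := by
  have hrep : Primrec fun x : ℕ => List.replicate x (T.a 1) := by
    refine (Primrec.nat_rec' (f := fun x : ℕ => x) (g := fun _ => ([] : List T.Letter))
      (h := fun _ p => T.a 1 :: p.2) Primrec.id (Primrec.const _)
      (Primrec.list_cons.comp (Primrec.const _) (Primrec.snd.comp Primrec.snd)).to₂).of_eq ?_
    intro x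
    induction x with
    | zero => rfl
    | succ x ih => simp only [ih, List.replicate_succ]
  have : Primrec fun x : ℕ => T.q 1 :: T.a 0 :: (List.replicate x (T.a 1) ++ [T.v]) :=
    Primrec.list_cons.comp (Primrec.const _) (Primrec.list_cons.comp (Primrec.const _)
      (Primrec.list_append.comp hrep (Primrec.const _)))
  exact this.to_comp.of_eq fun x => by simp [Config.word, initial]

/-- The left divisibility problem for `q_0 v` separates `E x = 0` from `E x = 1`. -/
theorem not_leftDivisibilityDecidable {E : ℕ →. ℕ} (hE : IsInextensible E) (hT : T.Computes E) :
    ¬ LeftDivisibilityDecidable T.Relations [T.q 0, T.v] := by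
  intro hdec
  obtain ⟨f, hf, hp⟩ := ComputablePred.computable_iff.1 hdec
  refine hE.no_extension ⟨fun x => bif f (T.initial x).word then 0 else 1,
    Computable.cond (hf.comp computable_initial_word) (Computable.const 0) (Computable.const 1), ?_⟩
  intro x y hy
  have hiff := congrFun hp (T.initial x).word
  rcases hE.values x y hy with rfl | rfl
  · have := hiff.mp (exists_dvd_of_mem_zero hT hy)
    simp [this]
  · have : ¬ f (T.initial x).word = true := fun h =>
      not_exists_dvd_of_mem_one hT hy (hiff.mpr h)
    simp [this]

end TuringMachine

end AssocCalculus
-- Register programs for primitive recursive functions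
namespace AssocCalculus

/-- Programs on registers that hold natural numbers. -/
inductive Prog where
  | skip
  | inc (r : ℕ)
  | seq (P Q : Prog)
  /-- While register `r` is not zero, decrease it and execute `P`. -/
  | loop (r : ℕ) (P : Prog)

open Function (update)

/-- The program transforms the registers from the first contents to the second. -/
inductive Prog.Exec : Prog → (ℕ → ℕ) → (ℕ → ℕ) → Prop
  | skip (s) : Exec .skip s s
  | inc (r s) : Exec (.inc r) s (update s r (s r + 1))
  | seq {P Q s t u} (hP : Exec P s t) (hQ : Exec Q t u) : Exec (.seq P Q) s u
  | loop_zero {r P s} (h : s r = 0) : Exec (.loop r P) s s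
  | loop_succ {r P s t u k} (h : s r = k + 1) (hP : Exec P (update s r k) t)
      (hl : Exec (.loop r P) t u) : Exec (.loop r P) s u

namespace Prog

theorem Exec.congr {P : Prog} {s t u : ℕ → ℕ} (h : P.Exec s t) (e : t = u) : P.Exec s u := e ▸ h

/-- Rule for counting loops: `σ k` describes the registers when `k` rounds remain. -/
theorem Exec.of_invariant {r : ℕ} {P : Prog} (σ : ℕ → ℕ → ℕ) (hr : ∀ k, σ k r = k) (N : ℕ)
    (h : ∀ k < N, P.Exec (update (σ (k + 1)) r k) (σ k)) : (loop r P).Exec (σ N) (σ 0) := by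
  induction N with
  | zero => exact .loop_zero (hr 0)
  | succ N ih => exact .loop_succ (hr _) (h N (by lia)) (ih fun k hk => h k (by lia))

/-- Set a register to zero. -/
def clear (r : ℕ) : Prog := loop r skip

theorem exec_clear (r : ℕ) (s : ℕ → ℕ) : (clear r).Exec s (update s r 0) := by
  have := Exec.of_invariant (r := r) (P := skip) (fun k => update s r k) (by simp) (s r)
    (fun k _ => by simpa using Exec.skip _)
  simpa [clear] using this

/-- Add a register to another one and set it to zero. -/
def move (r d : ℕ) : Prog := loop r (inc d)

theorem exec_move {r d : ℕ} (hrd : r ≠ d) (s : ℕ → ℕ) :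
    (move r d).Exec s (update (update s d (s d + s r)) r 0) := by
  have := Exec.of_invariant (r := r) (P := inc d)
    (fun k => update (update s d (s d + (s r - k))) r k) (by simp) (s r)
    (fun k hk => (Exec.inc _ _).congr (by
      funext j
      simp only [Function.update_apply]
      split_ifs <;> lia))
  simpa [move] using this

/-- Copy a register to an empty one, with the help of a second empty register. -/
def copy (r d t : ℕ) : Prog := seq (loop r (seq (inc d) (inc t))) (move t r)

theorem exec_copy {r d t : ℕ} (hrd : r ≠ d) (hrt : r ≠ t) (hdt : d ≠ t) {s : ℕ → ℕ}
    (hd : s d = 0) (ht : s t = 0) : (copy r d t).Exec s (update s d (s r)) := by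
  have := Exec.of_invariant (r := r) (P := seq (inc d) (inc t))
    (fun k => update (update (update s d (s r - k)) t (s r - k)) r k) (by simp) (s r)
    (fun k hk => (Exec.seq (Exec.inc _ _) (Exec.inc _ _)).congr (by
      funext j
      simp only [Function.update_apply]
      split_ifs <;> lia))
  have e : update (update (update s d (s r - s r)) t (s r - s r)) r (s r) = s := by
    funext j
    simp only [Function.update_apply]
    split_ifs <;> simp_all
  simp only [e] at this
  refine (Exec.seq this (exec_move hrt.symm _)).congr ?_
  funext j
  simp only [Function.update_apply]
  split_ifs <;> simp_all

theorem exists_clear_range (b n : ℕ) :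
    ∃ P : Prog, ∀ s, P.Exec s fun j => if b ≤ j ∧ j < b + n then 0 else s j := by
  induction n with
  | zero =>
    refine ⟨skip, fun s => (Exec.skip s).congr ?_⟩
    funext j
    rw [if_neg (by lia)]
  | succ n ih =>
    obtain ⟨P, hP⟩ := ih
    refine ⟨seq P (clear (b + n)), fun s => (Exec.seq (hP s) (exec_clear _ _)).congr ?_⟩
    funext j
    simp only [Function.update_apply]
    split_ifs <;> first | rfl | lia

/-- For any registers `v` and any `b` above them, a program computes `f` of the contents of `v`
into register `b`, if it is started with zero in all registers from `b` on. -/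
def Computable {n : ℕ} (f : List.Vector ℕ n → ℕ) : Prop :=
  ∀ (v : List.Vector ℕ n) (b : ℕ), (∀ i, v.get i < b) →
    ∃ P : Prog, ∀ s : ℕ → ℕ, (∀ j, b ≤ j → s j = 0) → P.Exec s (update s b (f (v.map s)))

theorem map_congr_get {n : ℕ} {v : List.Vector ℕ n} {s t : ℕ → ℕ}
    (h : ∀ i, s (v.get i) = t (v.get i)) : v.map s = v.map t :=
  List.Vector.ext fun i => by simpa using h i

theorem computable_get {n : ℕ} (i : Fin n) : Computable fun v : List.Vector ℕ n => v.get i := by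
  intro v b hb
  refine ⟨copy (v.get i) b (b + 1), fun s hs => ?_⟩
  have := hb i
  exact (exec_copy (by lia) (by lia) (by lia) (hs b le_rfl) (hs _ (by lia))).congr (by simp)

theorem computable_succ : Computable fun v : List.Vector ℕ 1 => v.head.succ := by
  intro v b hb
  obtain ⟨P, hP⟩ := computable_get 0 v b hb
  refine ⟨seq P (inc b), fun s hs => ((hP s hs).seq (Exec.inc _ _)).congr ?_⟩
  simp

/-- Each result occupies one register, so the next program is based one register higher; the
arguments lie below `b` and stay intact. -/
theorem exists_tuple {m n : ℕ} {g : Fin n → List.Vector ℕ m → ℕ} (hg : ∀ i, Computable (g i))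
    (v : List.Vector ℕ m) (b : ℕ) (hb : ∀ i, v.get i < b) :
    ∃ P : Prog, ∀ s : ℕ → ℕ, (∀ j, b ≤ j → s j = 0) → ∃ t, P.Exec s t ∧
      (∀ j < b, t j = s j) ∧ (∀ i : Fin n, t (b + i) = g i (v.map s)) ∧
      ∀ j, b + n ≤ j → t j = 0 := by
  induction n generalizing b with
  | zero => exact ⟨skip, fun s hs => ⟨s, .skip s, fun _ _ => rfl, fun i => i.elim0, hs⟩⟩
  | succ n ih =>
    obtain ⟨P, hP⟩ := hg 0 v b hb
    obtain ⟨Q, hQ⟩ := ih (fun i => hg i.succ) (b + 1) (fun i => (hb i).trans (by lia))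
    refine ⟨seq P Q, fun s hs => ?_⟩
    obtain ⟨t, ht, h1, h2, h3⟩ := hQ (update s b (g 0 (v.map s))) (fun j hj => by
      rw [Function.update_of_ne (by lia)]
      exact hs j (by lia))
    refine ⟨t, (hP s hs).seq ht, fun j hj => ?_, fun i => ?_, fun j hj => h3 j (by lia)⟩
    · rw [h1 j (by lia), Function.update_of_ne (by lia)]
    · refine Fin.cases ?_ (fun i => ?_) i
      · simpa using h1 b (by lia)
      · have e : v.map (update s b (g 0 (v.map s))) = v.map s :=
          map_congr_get fun i => Function.update_of_ne (hb i).ne _ _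
        rw [← e, ← h2 i, Fin.val_succ]
        congr 1
        lia

theorem computable_comp {m n : ℕ} {f : List.Vector ℕ n → ℕ} {g : Fin n → List.Vector ℕ m → ℕ}
    (hf : Computable f) (hg : ∀ i, Computable (g i)) :
    Computable fun a => f (List.Vector.ofFn fun i => g i a) := by
  intro v b hb
  obtain ⟨G, hG⟩ := exists_tuple hg v b hb
  -- Base `b + n` would do for the arguments, but for `n = 0` the final move needs a source
  -- different from `b`.
  obtain ⟨F, hF⟩ := hf (List.Vector.ofFn fun i => b + i) (b + n + 1) (fun i => by
    rw [List.Vector.get_ofFn]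
    lia)
  obtain ⟨C, hC⟩ := exists_clear_range b n
  refine ⟨seq G (seq F (seq C (move (b + n + 1) b))), fun s hs => ?_⟩
  obtain ⟨t, ht, h1, h2, h3⟩ := hG s hs
  refine (ht.seq ((hF t fun j hj => h3 j (by lia)).seq ((hC _).seq
    (exec_move (by lia) _)))).congr ?_
  have e : (List.Vector.ofFn fun i : Fin n => b + (i : ℕ)).map t =
      List.Vector.ofFn fun i => g i (v.map s) :=
    List.Vector.ext fun i => by simp [h2]
  rw [e]
  funext j
  -- For `n = 0` nothing is cleared, so register `b` must be known to be empty before the result is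
  -- added to it.
  have hbn : n = 0 → t b = 0 := fun h => h3 b (by lia)
  by_cases hj1 : j < b
  · grind [Function.update_apply]
  · grind [Function.update_apply]

theorem computable_prec {n : ℕ} {f : List.Vector ℕ n → ℕ} {g : List.Vector ℕ (n + 2) → ℕ}
    (hf : Computable f) (hg : Computable g) :
    Computable fun v : List.Vector ℕ (n + 1) =>
      v.head.rec (f v.tail) fun y IH => g (y ::ᵥ IH ::ᵥ v.tail) := by
  intro v b hb
  have hhead : v.head < b := by simpa using hb 0
  have htail : ∀ i : Fin n, v.tail.get i < b := fun i => by
    rw [List.Vector.get_tail_succ]; exact hb _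
  obtain ⟨F, hF⟩ := hf v.tail b htail
  obtain ⟨G, hG⟩ := hg ((b + 1) ::ᵥ b ::ᵥ v.tail) (b + 3) (fun i => by
    refine Fin.cases (by simp) (fun i => ?_) i
    rw [List.Vector.get_cons_succ]
    refine Fin.cases (by simp) (fun i => ?_) i
    rw [List.Vector.get_cons_succ]
    exact (htail i).trans (by lia))
  -- Register `b` holds the current value of the recursion, `b + 1` its index, `b + 2` the number of
  -- rounds left, and `b + 3` the next value. The counter is a copy because the argument itself must
  -- survive.
  refine ⟨seq F (seq (copy v.head (b + 2) (b + 3)) (seq (loop (b + 2)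
    (seq G (seq (clear b) (seq (move (b + 3) b) (inc (b + 1)))))) (clear (b + 1)))),
    fun s hs => ?_⟩
  have hmt : (v.map s).tail = v.tail.map s := List.Vector.tail_map v s
  have hmh : (v.map s).head = s v.head := List.Vector.head_map v s
  simp only [hmt, hmh]
  let R : ℕ → ℕ := fun k => k.rec (f (v.tail.map s)) fun y IH => g (y ::ᵥ IH ::ᵥ v.tail.map s)
  change Exec _ s (update s b (R (s v.head)))
  let N := s v.head
  let σ : ℕ → ℕ → ℕ := fun k =>
    update (update (update s b (R (N - k))) (b + 1) (N - k)) (b + 2) k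
  have hloop : (loop (b + 2) (seq G (seq (clear b) (seq (move (b + 3) b) (inc (b + 1)))))).Exec
      (σ N) (σ 0) := by
    refine Exec.of_invariant σ (by simp [σ]) N fun k hk => ?_
    have hz : ∀ j, b + 3 ≤ j → update (σ (k + 1)) (b + 2) k j = 0 := fun j hj => by
      have := hs j (by lia)
      simp only [σ, Function.update_apply]
      split_ifs <;> lia
    refine ((hG _ hz).seq ((exec_clear _ _).seq ((exec_move (by lia) _).seq (.inc _ _)))).congr ?_
    have hv : (((b + 1) ::ᵥ b ::ᵥ v.tail).map (update (σ (k + 1)) (b + 2) k)) =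
        (N - (k + 1)) ::ᵥ R (N - (k + 1)) ::ᵥ v.tail.map s := by
      have : v.tail.map (update (σ (k + 1)) (b + 2) k) = v.tail.map s :=
        map_congr_get fun i => by
          have := htail i
          simp only [σ, Function.update_apply]
          split_ifs <;> first | rfl | lia
      rw [List.Vector.map_cons, List.Vector.map_cons, this]
      simp [σ]
    have hR : R (N - k) = g ((N - (k + 1)) ::ᵥ R (N - (k + 1)) ::ᵥ v.tail.map s) := by
      rw [show N - k = (N - (k + 1)) + 1 by lia]
    rw [hv, ← hR]
    have h3 := hs (b + 3) (by lia)
    funext j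
    simp only [σ, Function.update_apply]
    grind
  have hcopy := exec_copy (r := v.head) (d := b + 2) (t := b + 3) (by lia) (by lia) (by lia)
    (s := update s b (f (v.tail.map s)))
    (by rw [Function.update_of_ne (by lia)]; exact hs _ (by lia))
    (by rw [Function.update_of_ne (by lia)]; exact hs _ (by lia))
  have h1 := hs (b + 1) (by lia)
  have h2 := hs (b + 2) (by lia)
  refine (hF s hs).seq ((hcopy.congr ?_).seq (hloop.seq ((exec_clear _ _).congr ?_)))
  · funext j
    have hR0 : R 0 = f (v.tail.map s) := rfl
    simp only [σ, Function.update_apply, N, Nat.sub_self, hR0]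
    grind
  · funext j
    simp only [σ, Function.update_apply, N, Nat.sub_zero]
    grind

theorem computable_of_primrec {n : ℕ} {f : List.Vector ℕ n → ℕ} (hf : Nat.Primrec' f) :
    Computable f := by
  induction hf with
  | zero => exact fun v b _ => ⟨skip, fun s hs => (Exec.skip s).congr (by simp [hs b le_rfl])⟩
  | succ => exact computable_succ
  | get i => exact computable_get i
  | comp g _ _ hf hg => exact computable_comp hf hg
  | prec _ _ hf hg => exact computable_prec hf hg

end Prog

end AssocCalculus
-- Compilation to register machine code
namespace AssocCalculus

open Function (update)

/-- Instructions of a register machine. -/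
inductive Op where
  | inc (r : ℕ)
  /-- Decrease register `r`, or jump to `t` if it is zero. -/
  | dec (r t : ℕ)
  | jmp (t : ℕ)

/-- The register that an instruction refers to. -/
def Op.reg : Op → ℕ
  | .inc r => r
  | .dec r _ => r
  | .jmp _ => 0

/-- One step of the register machine with code `L`; a state consists of the number of the next
instruction and the contents of the registers. -/
inductive RegStep (L : List Op) : ℕ × (ℕ → ℕ) → ℕ × (ℕ → ℕ) → Prop
  | inc {p r s} (h : L[p]? = some (.inc r)) : RegStep L (p, s) (p + 1, update s r (s r + 1))
  | dec_zero {p r t s} (h : L[p]? = some (.dec r t)) (hs : s r = 0) (ht : t ≤ L.length) :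
      RegStep L (p, s) (t, s)
  | dec_succ {p r t s k} (h : L[p]? = some (.dec r t)) (hs : s r = k + 1) :
      RegStep L (p, s) (p + 1, update s r k)
  | jmp {p t s} (h : L[p]? = some (.jmp t)) (ht : t ≤ L.length) : RegStep L (p, s) (t, s)

/-- `C` is the part of the code `L` that begins at `o`. -/
def Op.Occurs (L : List Op) (o : ℕ) (C : List Op) : Prop :=
  ∃ A B, L = A ++ C ++ B ∧ A.length = o

namespace Op.Occurs

variable {L C D : List Op} {o : ℕ}

theorem left (h : Occurs L o (C ++ D)) : Occurs L o C := by
  obtain ⟨A, B, rfl, rfl⟩ := h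
  exact ⟨A, D ++ B, by simp, rfl⟩

theorem right (h : Occurs L o (C ++ D)) : Occurs L (o + C.length) D := by
  obtain ⟨A, B, rfl, rfl⟩ := h
  exact ⟨A ++ C, B, by simp, by simp⟩

theorem getElem_eq {x : Op} (h : Occurs L o (x :: C)) : L[o]? = some x := by
  obtain ⟨A, B, rfl, rfl⟩ := h
  simp

theorem add_length_le (h : Occurs L o C) : o + C.length ≤ L.length := by
  obtain ⟨A, B, rfl, rfl⟩ := h
  simp

end Op.Occurs

namespace Prog

/-- Code of a program for the register machine, to be placed at `o`. -/
def compile : Prog → ℕ → List Op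
  | skip, _ => []
  | inc r, _ => [.inc r]
  | seq P Q, o => P.compile o ++ Q.compile (o + (P.compile o).length)
  | loop r P, o => .dec r (o + (P.compile (o + 1)).length + 2) :: (P.compile (o + 1) ++ [.jmp o])

theorem occurs_body {L : List Op} {r : ℕ} {P : Prog} {o : ℕ}
    (h : Op.Occurs L o ((loop r P).compile o)) : Op.Occurs L (o + 1) (P.compile (o + 1)) :=
  (Op.Occurs.right (C := [_]) h).left

theorem getElem_jmp_eq {L : List Op} {r : ℕ} {P : Prog} {o : ℕ}
    (h : Op.Occurs L o ((loop r P).compile o)) :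
    L[o + 1 + (P.compile (o + 1)).length]? = some (.jmp o) :=
  (Op.Occurs.right (C := [_]) h).right.getElem_eq

theorem Exec.reaches {P : Prog} {s s' : ℕ → ℕ} (h : P.Exec s s') {L : List Op} {o : ℕ}
    (hL : Op.Occurs L o (P.compile o)) :
    Relation.ReflTransGen (RegStep L) (o, s) (o + (P.compile o).length, s') := by
  induction h generalizing o with
  | skip s => exact .refl
  | inc r s => exact .single (.inc hL.getElem_eq)
  | @seq P Q s t u _ _ ihP ihQ =>
    have := (ihP hL.left).trans (ihQ hL.right)
    simpa [compile, Nat.add_assoc] using this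
  | @loop_zero r P s h =>
    have hlen := hL.add_length_le
    have e : o + ((loop r P).compile o).length = o + (P.compile (o + 1)).length + 2 := by
      simp [compile]
      lia
    rw [e] at hlen ⊢
    exact .single (.dec_zero hL.getElem_eq h hlen)
  | @loop_succ r P s t u k h _ _ ihP ihl =>
    refine .head (.dec_succ hL.getElem_eq h) ((ihP (occurs_body hL)).trans
      (.head (.jmp (getElem_jmp_eq hL) ?_) (ihl hL)))
    exact (Nat.le_add_right _ _).trans hL.add_length_le

/-- One turn of a loop. -/
theorem Exec.transGen_loop {P : Prog} {r : ℕ} {s s' : ℕ → ℕ} {k : ℕ} (hs : s r = k + 1)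
    (h : P.Exec (update s r k) s') {L : List Op} {o : ℕ}
    (hL : Op.Occurs L o ((loop r P).compile o)) :
    Relation.TransGen (RegStep L) (o, s) (o, s') := by
  refine .head' (.dec_succ hL.getElem_eq hs) ((h.reaches (occurs_body hL)).tail
    (.jmp (getElem_jmp_eq hL) ?_))
  exact (Nat.le_add_right _ _).trans hL.add_length_le

end Prog

/-! ### Configurations given by head position, and divergence -/

namespace TuringMachine

variable {T : TuringMachine}

/-- The configuration with tape `c` and head at cell `p`. -/
def posConfig (q : Fin (T.n + 2)) (c : ℕ → Fin (T.m + 2)) (p : ℕ) : T.HalfConfig :=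
  ⟨((List.range p).map c).reverse, q, fun i => c (p + i)⟩

theorem stepHalf_posConfig_right {q β} {c : ℕ → Fin (T.m + 2)} {p : ℕ}
    (h : T.instr q (c p) = some (.right β)) :
    T.stepHalf (posConfig q c p) = some (posConfig β c (p + 1)) := by
  simp only [stepHalf, posConfig, Nat.add_zero, h, Option.some.injEq, HalfConfig.mk.injEq,
    List.range_succ, List.map_append, List.reverse_append, true_and]
  refine ⟨rfl, funext fun i => ?_⟩
  congr 1
  lia

theorem stepHalf_posConfig_left {q β} {c : ℕ → Fin (T.m + 2)} {p : ℕ}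
    (h : T.instr q (c (p + 1)) = some (.left β)) :
    T.stepHalf (posConfig q c (p + 1)) = some (posConfig β c p) := by
  simp only [stepHalf, posConfig, Nat.add_zero, h, List.range_succ, List.map_append,
    List.reverse_append, List.map_cons, List.map_nil, List.reverse_singleton,
    List.singleton_append, Option.some.injEq, HalfConfig.mk.injEq, true_and]
  funext i
  cases i with
  | zero => rfl
  | succ i =>
    change c _ = c _
    congr 1
    lia

theorem stepHalf_posConfig_write {q β j} {c : ℕ → Fin (T.m + 2)} {p : ℕ}
    (h : T.instr q (c p) = some (.write β j)) :
    T.stepHalf (posConfig q c p) = some (posConfig β (update c p j) p) := by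
  simp only [stepHalf, posConfig, Nat.add_zero, h, Option.some.injEq, HalfConfig.mk.injEq,
    true_and]
  constructor
  · congr 1
    refine List.map_congr_left fun i hi => ?_
    rw [List.mem_range] at hi
    rw [Function.update_of_ne hi.ne]
  · funext i
    cases i with
    | zero => simp [consTape]
    | succ i => simp [consTape]

/-- A machine that passes through an infinite sequence of configurations does not stop. -/
theorem state_ne_zero_of_infinite {c : ℕ → T.HalfConfig}
    (hc : ∀ k, Relation.TransGen (fun a b => T.stepHalf a = some b) (c k) (c (k + 1)))
    {d : T.HalfConfig} (h : T.ReachesHalf (c 0) d) : d.state ≠ 0 := by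
  -- Being on the way to some `c k` survives every step: the path from `a` on to `c (k + 1)` is
  -- nonempty, and by determinism it begins with the only step available at `a`.
  have key : ∀ a, (∃ k, T.ReachesHalf a (c k)) →
      ∃ b, T.stepHalf a = some b ∧ ∃ k, T.ReachesHalf b (c k) := by
    rintro a ⟨k, hk⟩
    obtain ⟨b, hb, hr⟩ := Relation.TransGen.head'_iff.1 (Relation.TransGen.trans_right hk (hc k))
    exact ⟨b, hb, k + 1, hr⟩
  have hd : ∃ k, T.ReachesHalf d (c k) := by
    induction h with
    | refl => exact ⟨0, .refl⟩
    | @tail a b _ hs ih =>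
      obtain ⟨b', hb', hk⟩ := key a ih
      rw [hs, Option.some.injEq] at hb'
      exact hb' ▸ hk
  intro h0
  obtain ⟨b, hb, -⟩ := key d hd
  rw [stepHalf_final h0] at hb
  cases hb

end TuringMachine

/-! ### Simulation of a register machine by a Turing machine -/

namespace RegTM

/-- Phases in the execution of an instruction of the register machine. -/
inductive Phase where
  | start | scan | clear | back

/-- States of the Turing machine that simulates a register machine with code `L`. -/
inductive Ctrl (L : List Op) where
  | final
  | entry
  | run (pc : Fin (L.length + 1)) (φ : Phase)

instance : Finite Phase :=
  Finite.of_surjective (fun i : Fin 4 => match i with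
    | 0 => Phase.start | 1 => .scan | 2 => .clear | 3 => .back)
    (by rintro (_ | _ | _ | _) <;> [exact ⟨0, rfl⟩; exact ⟨1, rfl⟩; exact ⟨2, rfl⟩; exact ⟨3, rfl⟩])

instance (L : List Op) : Finite (Ctrl L) :=
  Finite.of_surjective (fun i : Option (Option (Fin (L.length + 1) × Phase)) => match i with
    | none => Ctrl.final | some none => .entry | some (some (pc, φ)) => .run pc φ)
    (by rintro (_ | _ | ⟨pc, φ⟩) <;>
      [exact ⟨none, rfl⟩; exact ⟨some none, rfl⟩; exact ⟨some (some (pc, φ)), rfl⟩])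

/-- Tape symbols: the mark of the left end, and one bit for each register. In the cell with number
`i` to the right of the mark, the bit of a register tells whether its content exceeds `i`. -/
abbrev Sym (N : ℕ) : Type := Option (Fin N → Bool)

/-- The default is immaterial: `N` will exceed every register named in the code. -/
def bit {N : ℕ} (f : Fin N → Bool) (r : ℕ) : Bool := if h : r < N then f ⟨r, h⟩ else false

def setBit {N : ℕ} (f : Fin N → Bool) (r : ℕ) (x : Bool) : Fin N → Bool :=
  fun j => if (j : ℕ) = r then x else f j

/-- The bits in cell `i`. -/
def cell (N : ℕ) (s : ℕ → ℕ) (i : ℕ) : Fin N → Bool := fun j => decide (i < s j)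

theorem bit_cell {N r : ℕ} (hr : r < N) (s : ℕ → ℕ) (i : ℕ) :
    bit (cell N s i) r = decide (i < s r) := by
  simp [bit, cell, hr]

/-- The state in which the instruction number `p` begins. -/
def instrState (L : List Op) (p : ℕ) (φ : Phase) : Ctrl L := .run (Fin.ofNat (L.length + 1) p) φ

section machine

variable {L : List Op} {N m n : ℕ} (eQ : Ctrl L ≃ Fin (n + 2)) (eS : Sym N ≃ Fin (m + 2))

/-- The instructions of the Turing machine. Between two instructions of the register machine its
head is at the left end. -/
def table : Ctrl L → Sym N → Option (Instr m n)
  | .final, _ => none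
  -- The leading blank of the input is replaced by the mark of the left end.
  | .entry, _ => some (.write (eQ (instrState L 0 .start)) (eS none))
  | .run pc .start, _ =>
    match L[(pc : ℕ)]? with
    -- Past the end of the code the mark becomes a blank again, as the output format requires.
    | none => some (.write (eQ .final) (eS (some fun _ => false)))
    | some (.jmp t) => some (.write (eQ (instrState L t .start)) (eS none))
    | some _ => some (.right (eQ (.run pc .scan)))
  | .run _ .scan, none => none
  | .run pc .scan, some f =>
    match L[(pc : ℕ)]? with
    | some (.inc r) =>
      if bit f r then some (.right (eQ (.run pc .scan)))
      else some (.write (eQ (.run pc .back)) (eS (some (setBit f r true))))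
    | some (.dec r _) =>
      -- One cell left of the first unset bit is either the last set bit, to be cleared, or the
      -- mark, in which case the register is zero and the jump is taken.
      if bit f r then some (.right (eQ (.run pc .scan))) else some (.left (eQ (.run pc .clear)))
    | _ => none
  | .run pc .clear, none =>
    match L[(pc : ℕ)]? with
    | some (.dec _ t) => some (.write (eQ (instrState L t .start)) (eS none))
    | _ => none
  | .run pc .clear, some f =>
    match L[(pc : ℕ)]? with
    | some (.dec r _) => some (.write (eQ (.run pc .back)) (eS (some (setBit f r false))))
    | _ => none
  | .run pc .back, none => some (.write (eQ (instrState L (pc + 1) .start)) (eS none))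
  | .run pc .back, some _ => some (.left (eQ (.run pc .back)))

/-- The Turing machine that simulates the register machine with code `L`. -/
@[reducible]
def machine (h0 : eQ .final = 0) : TuringMachine where
  m := m
  n := n
  instr α i := table eQ eS (eQ.symm α) (eS.symm i)
  final i := by
    rw [← h0, Equiv.symm_apply_apply]
    rfl

/-- The tape with the contents `s` of the registers. -/
def tape (s : ℕ → ℕ) : ℕ → Fin (m + 2)
  | 0 => eS none
  | i + 1 => eS (some (cell N s i))

theorem update_tape_zero (s : ℕ → ℕ) : update (tape eS s) 0 (eS none) = tape eS s := by
  exact Function.update_eq_self 0 (tape eS s)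

/-- In unary, adding one changes a single bit, that of cell `s r`; the mark shifts this cell to
position `s r + 1`. -/
theorem update_tape_inc {r : ℕ} (s : ℕ → ℕ) :
    update (tape eS s) (s r + 1) (eS (some (setBit (cell N s (s r)) r true))) =
      tape eS (update s r (s r + 1)) := by
  funext i
  rcases i with _ | i
  · rw [Function.update_of_ne (by lia)]; rfl
  · by_cases hi : i = s r
    · subst hi
      rw [Function.update_self]
      simp only [tape]
      congr 2
      funext j
      simp only [setBit, cell, Function.update_apply]
      split_ifs <;> simp
    · rw [Function.update_of_ne (by lia)]
      simp only [tape]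
      congr 2
      funext j
      simp only [cell, Function.update_apply]
      split_ifs with h
      · rw [h, decide_eq_decide]
        lia
      · rfl

theorem update_tape_dec {r k : ℕ} {s : ℕ → ℕ} (hk : s r = k + 1) :
    update (tape eS s) (k + 1) (eS (some (setBit (cell N s k) r false))) =
      tape eS (update s r k) := by
  funext i
  rcases i with _ | i
  · rw [Function.update_of_ne (by lia)]; rfl
  · by_cases hi : i = k
    · subst hi
      rw [Function.update_self]
      simp only [tape]
      congr 2
      funext j
      simp only [setBit, cell, Function.update_apply]
      split_ifs <;> simp
    · rw [Function.update_of_ne (by lia)]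
      simp only [tape]
      congr 2
      funext j
      simp only [cell, Function.update_apply]
      split_ifs with h
      · rw [h, decide_eq_decide]
        lia
      · rfl

open TuringMachine

variable {eQ eS} (h0 : eQ .final = 0)

theorem machine_instr (x : Ctrl L) (y : Sym N) :
    (machine eQ eS h0).instr (eQ x) (eS y) = table eQ eS x y := by
  simp [machine]

/-- The configuration of the simulating machine with head at cell `p`. -/
def conf (x : Ctrl L) (s : ℕ → ℕ) (p : ℕ) : (machine eQ eS h0).HalfConfig :=
  posConfig (T := machine eQ eS h0) (eQ x) (tape eS s) p

theorem step_right {x y : Ctrl L} {s : ℕ → ℕ} {p : ℕ} {g : Sym N} (hg : tape eS s p = eS g)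
    (h : table eQ eS x g = some (.right (eQ y))) :
    (machine eQ eS h0).stepHalf (conf h0 x s p) = some (conf h0 y s (p + 1)) := by
  refine stepHalf_posConfig_right (T := machine eQ eS h0) ?_
  rw [hg]
  exact (machine_instr h0 x g).trans h

theorem step_left {x y : Ctrl L} {s : ℕ → ℕ} {p : ℕ} {g : Sym N} (hg : tape eS s (p + 1) = eS g)
    (h : table eQ eS x g = some (.left (eQ y))) :
    (machine eQ eS h0).stepHalf (conf h0 x s (p + 1)) = some (conf h0 y s p) := by
  refine stepHalf_posConfig_left (T := machine eQ eS h0) ?_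
  rw [hg]
  exact (machine_instr h0 x g).trans h

theorem step_write {x y : Ctrl L} {s s' : ℕ → ℕ} {p : ℕ} {g g' : Sym N}
    (hg : tape eS s p = eS g) (h : table eQ eS x g = some (.write (eQ y) (eS g')))
    (hs : update (tape eS s) p (eS g') = tape eS s') :
    (machine eQ eS h0).stepHalf (conf h0 x s p) = some (conf h0 y s' p) := by
  rw [conf, conf, ← hs]
  refine stepHalf_posConfig_write (T := machine eQ eS h0) ?_
  rw [hg]
  exact (machine_instr h0 x g).trans h

/-- The set bits of register `r` fill exactly the first `s r` cells after the mark. Hypothesis `h`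
covers both kinds of instruction that scan. -/
theorem reaches_scan {pc : Fin (L.length + 1)} {r : ℕ} (hr : r < N)
    (h : ∀ f : Fin N → Bool, bit f r = true →
      table eQ eS (.run pc .scan) (some f) = some (.right (eQ (.run pc .scan))))
    (s : ℕ → ℕ) {p : ℕ} (hp : p ≤ s r) :
    (machine eQ eS h0).ReachesHalf (conf h0 (.run pc .scan) s 1)
      (conf h0 (.run pc .scan) s (p + 1)) := by
  induction p with
  | zero => exact .refl
  | succ p ih =>
    refine (ih (by lia)).tail (step_right h0 (g := some (cell N s p)) rfl (h _ ?_))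
    rw [bit_cell hr, decide_eq_true_iff]
    lia

theorem reaches_back (pc : Fin (L.length + 1)) (s : ℕ → ℕ) (p : ℕ) :
    (machine eQ eS h0).ReachesHalf (conf h0 (.run pc .back) s p)
      (conf h0 (instrState L (pc + 1) .start) s 0) := by
  induction p with
  | zero => exact .single (step_write h0 (g := none) rfl rfl (update_tape_zero eS s))
  | succ p ih => exact .head (step_left h0 (g := some (cell N s p)) rfl rfl) ih

/-- Larger numbers would wrap around; this is why `RegStep` restricts the targets of its jumps. -/
theorem ofNat_val {p : ℕ} (hp : p ≤ L.length) : ((Fin.ofNat (L.length + 1) p : Fin _) : ℕ) = p :=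
  Nat.mod_eq_of_lt (by lia)

/-- The Turing machine simulates a step of the register machine. -/
theorem transGen_of_regStep (hN : ∀ x ∈ L, x.reg < N) {a b : ℕ × (ℕ → ℕ)} (h : RegStep L a b) :
    Relation.TransGen (fun c d => (machine eQ eS h0).stepHalf c = some d)
      (conf h0 (instrState L a.1 .start) a.2 0) (conf h0 (instrState L b.1 .start) b.2 0) := by
  have hlen : ∀ {p x}, L[p]? = some x → p ≤ L.length := fun h =>
    (List.getElem?_eq_some_iff.1 h).1.le
  cases h with
  | @inc p r s h =>
    have hr : r < N := hN _ (List.mem_of_getElem? h)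
    have hp := ofNat_val (hlen h)
    have hb := reaches_back h0 (eS := eS) (Fin.ofNat (L.length + 1) p) (update s r (s r + 1))
      (s r + 1)
    rw [hp] at hb
    refine .head' (step_right h0 (g := none) rfl (y := .run (Fin.ofNat _ p) .scan) ?_)
      ((reaches_scan h0 hr ?_ s le_rfl).trans
        (.head (step_write h0 (g := some (cell N s (s r))) rfl
          (y := .run (Fin.ofNat _ p) .back) ?_ (update_tape_inc eS s)) hb))
    · simp only [instrState, table, hp, h]
    · intro f hf
      simp only [table, hp, h, hf, if_true]
    · simp only [table, hp, h, bit_cell hr, lt_irrefl, decide_false, Bool.false_eq_true, if_false]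
  | @dec_zero p r t s h hs ht =>
    have hr : r < N := hN _ (List.mem_of_getElem? h)
    have hp := ofNat_val (hlen h)
    refine .head (step_right h0 (g := none) rfl (y := .run (Fin.ofNat _ p) .scan) ?_)
      (.head (step_left h0 (g := some (cell N s 0)) rfl (y := .run (Fin.ofNat _ p) .clear) ?_)
        (.single (step_write h0 (g := none) rfl ?_ (update_tape_zero eS s))))
    · simp only [instrState, table, hp, h]
    · simp only [table, hp, h, bit_cell hr, hs, lt_irrefl, decide_false, Bool.false_eq_true,
        if_false]
    · simp only [table, hp, h]
  | @dec_succ p r t s k h hs =>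
    have hr : r < N := hN _ (List.mem_of_getElem? h)
    have hp := ofNat_val (hlen h)
    have hb := reaches_back h0 (eS := eS) (Fin.ofNat (L.length + 1) p) (update s r k) (k + 1)
    rw [hp] at hb
    -- The scan ends at position `k + 2`, one past the last set bit, so a left step precedes the
    -- clearing.
    have hsc := reaches_scan h0 (eS := eS) (pc := Fin.ofNat (L.length + 1) p) hr ?_ s
      (p := k + 1) (by lia)
    refine .head' (step_right h0 (g := none) rfl (y := .run (Fin.ofNat _ p) .scan) ?_)
      (hsc.trans (.head (step_left h0 (g := some (cell N s (k + 1))) rfl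
        (y := .run (Fin.ofNat _ p) .clear) ?_)
        (.head (step_write h0 (g := some (cell N s k)) rfl
          (y := .run (Fin.ofNat _ p) .back) ?_ (update_tape_dec eS hs)) hb)))
    · simp only [instrState, table, hp, h]
    · simp only [table, hp, h, bit_cell hr, hs, lt_irrefl, decide_false, Bool.false_eq_true,
        if_false]
    · simp only [table, hp, h]
    · intro f hf
      simp only [table, hp, h, hf, if_true]
  | @jmp p t s h ht =>
    have hp := ofNat_val (hlen h)
    refine .single (step_write h0 (g := none) rfl ?_ (update_tape_zero eS s))
    simp only [instrState, table, hp, h]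

/-- The registers that hold `x, 0, 0, …`. -/
def single (x : ℕ) : ℕ → ℕ := update (fun _ => 0) 0 x

/-- The symbol `1` is the cell where only register 0 has its bit set and the blank is the cell with
no bits, so input and output words are themselves register encodings and need no conversion. -/
theorem tape_single (hS0 : eS (some fun _ => false) = 0)
    (hS1 : eS (some fun j => decide ((j : ℕ) = 0)) = 1) (y i : ℕ) :
    tape eS (single y) (i + 1) = if i < y then 1 else 0 := by
  simp only [tape]
  split_ifs with h
  · rw [← hS1]
    congr 2
    funext j
    simp only [cell, single, Function.update_apply]
    split_ifs with hj <;> simp [hj, h]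
  · rw [← hS0]
    congr 2
    funext j
    simp only [cell, single, Function.update_apply]
    split_ifs
    · simpa using h
    · simp

theorem step_initial (h1 : eQ .entry = 1) (hS0 : eS (some fun _ => false) = 0)
    (hS1 : eS (some fun j => decide ((j : ℕ) = 0)) = 1) (x : ℕ) :
    (machine eQ eS h0).stepHalf ((machine eQ eS h0).initial x).toHalf =
      some (conf h0 (instrState L 0 .start) (single x) 0) := by
  have hi : table eQ eS (eQ.symm 1) (eS.symm 0) =
      some (.write (eQ (instrState L 0 .start)) (eS none)) := by
    rw [← h1, Equiv.symm_apply_apply]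
    rfl
  simp only [stepHalf, initial, Config.toHalf, consTape]
  rw [hi]
  simp only [conf, posConfig, Option.some.injEq, HalfConfig.mk.injEq]
  refine ⟨by simp, by trivial, funext fun i => ?_⟩
  rw [Nat.zero_add]
  cases i with
  | zero => rfl
  | succ i =>
    rw [tape_single hS0 hS1]
    change (List.replicate x (1 : Fin (m + 2))).getD i 0 = _
    rw [List.getD_eq_getElem?_getD, List.getElem?_replicate]
    split_ifs <;> rfl

theorem eq_output (hS0 : eS (some fun _ => false) = 0)
    (hS1 : eS (some fun j => decide ((j : ℕ) = 0)) = 1) {d : (machine eQ eS h0).Config} {y : ℕ}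
    (hd : d.toHalf = posConfig (T := machine eQ eS h0) 0 (update (tape eS (single y)) 0 0) 0) :
    ∃ k, d = (machine eQ eS h0).output y k := by
  obtain ⟨l, q, x, r⟩ := d
  simp only [Config.toHalf, posConfig, HalfConfig.mk.injEq] at hd
  obtain ⟨rfl, rfl, hr⟩ := hd
  have hx : x = 0 := by simpa [consTape] using congrFun hr 0
  have hget : ∀ i, r.getD i 0 = if i < y then 1 else 0 := fun i => by
    have := congrFun hr (i + 1)
    rw [Nat.zero_add, Function.update_of_ne (by lia)] at this
    exact this.trans (tape_single hS0 hS1 y i)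
  -- Beyond the end of `r` the tape is blank, but its first `y` cells after the head hold `1`.
  have hy : y ≤ r.length := by
    by_contra! hlt
    have := hget r.length
    rw [if_pos hlt, List.getD_eq_default _ _ le_rfl] at this
    exact absurd this (by simp)
  refine ⟨r.length - y, ?_⟩
  simp only [output, hx, List.range_zero, List.map_nil, Config.mk.injEq,
    List.reverse_nil, true_and]
  refine List.ext_getElem (by simp [hy]) fun i hi hi' => ?_
  have := hget i
  rw [List.getD_eq_getElem _ _ hi] at this
  rw [this]
  simp only [List.getElem_append, List.length_replicate, List.getElem_replicate]
  split_ifs <;> rfl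

end machine

end RegTM

end AssocCalculus
-- Existence of an inextensible function and a machine for it
namespace AssocCalculus

open Function (update)

/-- Numbers states and symbols with the final and initial state, or the blank and `1`, in the places
0 and 1. The second swap does not disturb the first, since it does not involve 0. -/
theorem exists_equiv_fin {X : Type} [Finite X] {x y : X} (h : x ≠ y) :
    ∃ (n : ℕ) (e : X ≃ Fin (n + 2)), e x = 0 ∧ e y = 1 := by
  have : Nontrivial X := ⟨x, y, h⟩
  obtain ⟨n, hn⟩ : ∃ n, Nat.card X = n + 2 :=
    ⟨Nat.card X - 2, by have := Finite.one_lt_card (α := X); lia⟩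
  let e := (Finite.equivFin X).trans (finCongr hn)
  let e₁ := e.trans (Equiv.swap (e x) 0)
  have hx : e₁ x = 0 := Equiv.swap_apply_left _ _
  have hy : e₁ y ≠ 0 := fun hy => h (e₁.injective (hx.trans hy.symm))
  refine ⟨n, e₁.trans (Equiv.swap (e₁ y) 1), ?_, Equiv.swap_apply_left _ _⟩
  rw [Equiv.trans_apply, hx]
  exact Equiv.swap_apply_of_ne_of_ne hy.symm (by simp)

open RegTM TuringMachine

/-- Every register machine is simulated by a Turing machine. -/
theorem exists_turingMachine (L : List Op) : ∃ T : TuringMachine, ∀ x,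
    (∀ y, Relation.ReflTransGen (RegStep L) (0, single x) (L.length, single y) →
      ∃ k, T.Reaches (T.initial x) (T.output y k)) ∧
    ∀ c : ℕ → ℕ × (ℕ → ℕ), Relation.ReflTransGen (RegStep L) (0, single x) (c 0) →
      (∀ k, Relation.TransGen (RegStep L) (c k) (c (k + 1))) →
      ∀ d, T.Reaches (T.initial x) d → d.state ≠ 0 := by
  -- Any bound on the registers in use works; that it is positive makes register 0 exist, which
  -- tells `1` from the blank.
  let N := (L.map Op.reg).sum + 1
  have hN : ∀ op ∈ L, op.reg < N := fun op hop =>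
    Nat.lt_succ_of_le (List.single_le_sum (by simp) _ (List.mem_map_of_mem hop))
  obtain ⟨n, eQ, h0, h1⟩ := exists_equiv_fin (X := Ctrl L) (x := .final) (y := .entry) nofun
  obtain ⟨m, eS, hS0, hS1⟩ := exists_equiv_fin (X := Sym N) (x := some fun _ => false)
    (y := some fun j => decide ((j : ℕ) = 0)) (fun h => by
      simpa using congrFun (Option.some.inj h) ⟨0, Nat.succ_pos _⟩)
  let f : ℕ × (ℕ → ℕ) → (machine eQ eS h0).HalfConfig := fun a =>
    conf h0 (instrState L a.1 .start) a.2 0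
  have hfirst : ∀ x, (machine eQ eS h0).stepHalf ((machine eQ eS h0).initial x).toHalf =
    some (f (0, single x)) := step_initial h0 h1 hS0 hS1
  have hstep : ∀ a b, RegStep L a b →
      Relation.TransGen (fun c d => (machine eQ eS h0).stepHalf c = some d) (f a) (f b) :=
    fun a b hab => transGen_of_regStep h0 hN hab
  have hreach : ∀ a b, Relation.ReflTransGen (RegStep L) a b →
      (machine eQ eS h0).ReachesHalf (f a) (f b) := fun a b hab => by
    induction hab with
    | refl => exact .refl
    | tail _ h ih => exact ih.trans (hstep _ _ h).to_reflTransGen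
  refine ⟨machine eQ eS h0, fun x => ⟨fun y hy => ?_, fun c hc0 hc d hd => ?_⟩⟩
  · have hlast : (machine eQ eS h0).stepHalf (f (L.length, single y)) =
        some (posConfig (T := machine eQ eS h0) 0 (update (tape eS (single y)) 0 0) 0) := by
      refine stepHalf_posConfig_write (T := machine eQ eS h0) ?_
      refine (machine_instr h0 _ none).trans ?_
      simp only [instrState, table, ofNat_val le_rfl, List.getElem?_eq_none le_rfl, h0, hS0]
    obtain ⟨d, hd, hd'⟩ := exists_reaches_of_reachesHalf
      (Relation.ReflTransGen.head (hfirst x) ((hreach _ _ hy).tail hlast))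
    obtain ⟨k, rfl⟩ := eq_output h0 hS0 hS1 hd'
    exact ⟨k, hd⟩
  · have hinf : ∀ a b, Relation.TransGen (RegStep L) a b →
        Relation.TransGen (fun a b => (machine eQ eS h0).stepHalf a = some b) (f a) (f b) := by
      intro a b hab
      induction hab with
      | single h => exact hstep _ _ h
      | tail _ h ih => exact ih.trans (hstep _ _ h)
    -- The initial configuration is put in front, so that the infinite sequence starts where the run
    -- does.
    let c' : ℕ → (machine eQ eS h0).HalfConfig := fun k =>
      Nat.casesOn k ((machine eQ eS h0).initial x).toHalf fun k => f (c k)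
    refine state_ne_zero_of_infinite (c := c') (fun k => ?_) (Reaches.toHalf hd)
    cases k with
    | zero => exact .head' (hfirst x) (hreach _ _ hc0)
    | succ k => exact hinf _ _ (hc k)

/-- A minimum search in a primitive recursive function, followed by a primitive recursive
function, is computed by a Turing machine. -/
theorem exists_computes_rfind {t u : ℕ → ℕ → ℕ} (ht : Primrec₂ t) (hu : Primrec₂ u) :
    ∃ T : TuringMachine, T.Computes fun x =>
      (Nat.rfind fun k => Part.some (decide (t x k = 0))).map (u x) := by
  have hprog : ∀ g : ℕ → ℕ → ℕ, Primrec₂ g → ∃ P : Prog, ∀ s : ℕ → ℕ, (∀ j, 2 ≤ j → s j = 0) →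
      P.Exec s (update s 2 (g (s 0) (s 1))) := fun g hg => by
    have hg' : Primrec fun v : List.Vector ℕ 2 => g (v.get 0) (v.get 1) :=
      hg.comp (Primrec.vector_get.comp .id (.const 0)) (Primrec.vector_get.comp .id (.const 1))
    obtain ⟨P, hP⟩ := Prog.computable_of_primrec (Nat.Primrec'.of_prim hg') (0 ::ᵥ 1 ::ᵥ .nil) 2
      (fun i => by
        fin_cases i
        exacts [Nat.zero_lt_two, Nat.one_lt_two])
    exact ⟨P, fun s hs => hP s hs⟩
  obtain ⟨A, hA⟩ := hprog t ht
  obtain ⟨B, hB⟩ := hprog u hu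
  -- Register 0 holds `x`, 1 the candidate `k`, and 2 the value `t x k`, which doubles as the loop
  -- condition. What the loop's decrement leaves there is cleared, since `A` expects empty registers
  -- from 2 on.
  let W : Prog := .seq (.clear 2) (.seq (.inc 1) A)
  let C : Prog := .seq B (.seq (.clear 0) (.seq (.clear 1) (.move 2 0)))
  let M : Prog := .seq A (.seq (.loop 2 W) C)
  let σ : ℕ → ℕ → ℕ → ℕ := fun x k => update (update (single x) 1 k) 2 (t x k)
  have hA0 : ∀ x, A.Exec (single x) (σ x 0) := fun x => by
    refine (hA _ fun j hj => ?_).congr ?_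
    · exact Function.update_of_ne (by lia) _ _
    · funext j
      simp only [σ, single, Function.update_apply]
      split_ifs <;> simp_all
  have hW : ∀ x k j, W.Exec (update (σ x k) 2 j) (σ x (k + 1)) := fun x k j => by
    refine ((Prog.exec_clear _ _).seq ((Prog.Exec.inc _ _).seq (hA _ fun i hi => ?_))).congr ?_
    · simp only [σ, single, Function.update_apply]
      split_ifs <;> first | rfl | lia
    · funext i
      simp only [σ, single, Function.update_apply]
      split_ifs <;> simp_all
  have hC : ∀ x k, t x k = 0 → C.Exec (σ x k) (single (u x k)) := fun x k h => by
    refine ((hB _ fun i hi => ?_).seq ((Prog.exec_clear _ _).seq ((Prog.exec_clear _ _).seq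
      (Prog.exec_move (by lia) _)))).congr ?_
    · simp only [σ, single, Function.update_apply]
      split_ifs <;> first | assumption | rfl | lia
    · funext i
      simp only [σ, single, Function.update_apply]
      split_ifs <;> simp_all
  have hocc : Op.Occurs (M.compile 0) 0 (M.compile 0) := ⟨[], [], by simp, rfl⟩
  obtain ⟨T, hT⟩ := exists_turingMachine (M.compile 0)
  refine ⟨T, fun x => ⟨fun y hy => ?_, fun hE => ?_⟩⟩
  · obtain ⟨K, hK, rfl⟩ := (Part.mem_map_iff _).1 hy
    have hK0 : t x K = 0 := by simpa using Nat.rfind_spec hK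
    have hlt : ∀ k < K, t x k ≠ 0 := fun k hk => by simpa using Nat.rfind_min hK hk
    -- Induction on the number `i` of candidates still to be rejected.
    have hloop : ∀ i ≤ K, (Prog.loop 2 W).Exec (σ x (K - i)) (σ x K) := fun i => by
      induction i with
      | zero => exact fun _ => .loop_zero (by simpa [σ] using hK0)
      | succ i ih =>
        intro hi
        obtain ⟨z, hz⟩ := Nat.exists_eq_succ_of_ne_zero (hlt (K - (i + 1)) (by lia))
        refine .loop_succ (k := z) (by simpa [σ] using hz) (hW _ _ _) ?_
        rw [show K - (i + 1) + 1 = K - i by lia]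
        exact ih (by lia)
    have hM : M.Exec (single x) (single (u x K)) :=
      (hA0 x).seq ((by simpa using hloop K le_rfl : Prog.Exec _ _ _).seq (hC x K hK0))
    refine (hT x).1 _ ?_
    simpa using hM.reaches hocc
  · have hne : ∀ k, t x k ≠ 0 := fun k hk => hE (by
      change (Nat.rfind _).Dom
      exact Nat.rfind_dom.2 ⟨k, by simpa using hk, fun _ => trivial⟩)
    -- If the search fails, the head of the loop is visited once for every `k`.
    refine (hT x).2 (fun k => (0 + (A.compile 0).length, σ x k)) ((hA0 x).reaches hocc.left)
      fun k => ?_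
    obtain ⟨z, hz⟩ := Nat.exists_eq_succ_of_ne_zero (hne k)
    exact Prog.Exec.transGen_loop (k := z) (by simpa [σ] using hz) (hW x k z) hocc.right.left

open Nat.Partrec (Code)

/-- Diagonalization: a partial recursive function with values `0` and `1` that differs from every
total recursive function, and that is given by a minimum search. -/
theorem exists_isInextensible_rfind : ∃ t u : ℕ → ℕ → ℕ, Primrec₂ t ∧ Primrec₂ u ∧
    IsInextensible fun x => (Nat.rfind fun k => Part.some (decide (t x k = 0))).map (u x) := by
  -- Evaluation of program `x` on its own number with bound `k`: primitive recursive, unlike the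
  -- unbounded evaluation.
  let e : ℕ → ℕ → Option ℕ := fun x k => Code.evaln k (Denumerable.ofNat Code x) x
  have he : Primrec₂ e := Code.primrec_evaln.comp
    ((Primrec.snd.pair ((Primrec.ofNat Code).comp Primrec.fst)).pair Primrec.fst)
  let t : ℕ → ℕ → ℕ := fun x k => bif (e x k).isSome then 0 else 1
  -- The value always differs from the result of program `x` at `x`.
  let u : ℕ → ℕ → ℕ := fun x k => if e x k = some 0 then 1 else 0
  have ht : Primrec₂ t :=
    Primrec.cond (Primrec.option_isSome.comp he) (Primrec.const 0) (Primrec.const 1)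
  have hu : Primrec₂ u :=
    Primrec.ite (Primrec.eq.comp he (Primrec.const _)) (Primrec.const 1) (Primrec.const 0)
  have ht0 : ∀ x k, t x k = 0 ↔ (e x k).isSome := fun x k => by
    cases h : (e x k).isSome <;> simp [t, h]
  refine ⟨t, u, ht, hu, ?_, fun x y hy => ?_, ?_⟩
  · refine Partrec.map (Partrec.rfind (p := fun x k => Part.some (decide (t x k = 0))) ?_)
      hu.to_comp
    exact (Primrec.eq.decide.comp ht (Primrec.const 0)).to_comp.partrec
  · obtain ⟨k, -, rfl⟩ := (Part.mem_map_iff _).1 hy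
    by_cases h : e x k = some 0 <;> simp [u, h]
  · rintro ⟨f, hf, hext⟩
    obtain ⟨c, hc⟩ := Code.exists_code.1 (Partrec.nat_iff.1 hf)
    let x := Encodable.encode c
    have hx : f x ∈ Code.eval c x := by rw [hc]; exact Part.mem_some _
    -- The search may stop at another bound than the one found below for `f x`, but every successful
    -- bound yields the same result.
    have hex : ∀ k z, z ∈ e x k → z = f x := fun k z hz => by
      have hz' : z ∈ Code.eval c x := by
        have := Code.evaln_sound hz
        rwa [Denumerable.ofNat_encode] at this
      exact Part.mem_unique hz' hx
    obtain ⟨k, hk⟩ := Code.evaln_complete.1 hx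
    have hk' : (e x k).isSome := by
      have : e x k = some (f x) := by
        simp only [e, x, Denumerable.ofNat_encode]
        exact hk
      simp [this]
    have hdom : (Nat.rfind fun k => Part.some (decide (t x k = 0))).Dom :=
      Nat.rfind_dom.2 ⟨k, by simpa using (ht0 x k).2 hk', fun _ => trivial⟩
    obtain ⟨K, hK⟩ := Part.dom_iff_mem.1 hdom
    have hK0 : t x K = 0 := by simpa using Nat.rfind_spec hK
    obtain ⟨z, hz⟩ := Option.isSome_iff_exists.1 ((ht0 x K).1 hK0)
    have hzf := hex K z hz
    have huf := hext x (u x K) (Part.mem_map _ hK)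
    simp only [u, hz, Option.some.injEq] at huf
    split_ifs at huf <;> lia

end AssocCalculus

theorem mainTheorem3 :
    (∃ (E : ℕ →. ℕ) (T : AssocCalculus.TuringMachine),
      AssocCalculus.IsInextensible E ∧ T.Computes E) ∧
    ∀ (E : ℕ →. ℕ) (T : AssocCalculus.TuringMachine),
      AssocCalculus.IsInextensible E → T.Computes E →
        ¬ AssocCalculus.LeftDivisibilityDecidable T.Relations [T.q 0, T.v] := by
  obtain ⟨t, u, ht, hu, hE⟩ := AssocCalculus.exists_isInextensible_rfind
  obtain ⟨T, hT⟩ := AssocCalculus.exists_computes_rfind ht hu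
  exact ⟨⟨_, T, hE, hT⟩, fun E T hE hT =>
    AssocCalculus.TuringMachine.not_leftDivisibilityDecidable hE hT⟩
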